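/- Let $n\ge 1$, let $u_i\ge 0$, $0<\rho_i<1$ and $c_i\in\mathbb{R}$ ($i=1,\dots,n$) be constants with $u_i>0$ for at least one $i$, and let $X,\xi_1,\dots,\xi_n$ be independent standard normal random variables. Put $$L_n=\sum_{i=1}^n u_i\,\mathbf 1_{\{\sqrt{\rho_i}\,X+\sqrt{1-\rho_i}\,\xi_i\le c_i\}},\qquad g_n(x)=\sum_{i=1}^n u_i\,\Phi\Bigl(\tfrac{c_i-\sqrt{\rho_i}\,x}{\sqrt{1-\rho_i}}\Bigr),$$ where $\Phi$ and $\phi$ are the distribution function and the density of the standard normal distribution. For $\beta\in(0,1)$ and a random variable $Y$ let $q_\beta(Y)=\inf\{y\in\mathbb{R}:\mathrm P[Y\le y]\ge\beta\}$. Fix $\alpha\in(0,1)$, and write $$Q(h)=q_\alpha\bigl(\mathrm E[L_n\,|\,X]+h\,(L_n-\mathrm E[L_n\,|\,X])\bigr),\qquad h\in\mathbb{R},$$ so that $Q(1)=q_\alpha(L_n)$. Then $\mathrm E[L_n\,|\,X]=g_n(X)$ almost surely, $g_n$ is twice continuously differentiable with $g_n'(q_{1-\alpha}(X))\neq 0$,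 $Q$ is twice continuously differentiable in a neighbourhood of $0$, and the second order Taylor approximation $Q(0)+Q'(0)+\tfrac12 Q''(0)$ of $q_\alpha(L_n)$ is given, with $z=q_{1-\alpha}(X)$ and $t_i=\frac{c_i-\sqrt{\rho_i}\,z}{\sqrt{1-\rho_i}}$, by $$Q(0)+Q'(0)+\tfrac12 Q''(0)=g_n(z)+\frac{\displaystyle\sum_{i=1}^n u_i^2\sqrt{\tfrac{\rho_i}{1-\rho_i}}\;\phi(t_i)\,\bigl(1-2\,\Phi(t_i)\bigr)+\Bigl(z+\frac{g_n''(z)}{g_n'(z)}\Bigr)\sum_{i=1}^n u_i^2\,\bigl(\Phi(t_i)-\Phi(t_i)^2\bigr)}{2\,g_n'(z)}.$$ -/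

import Mathlib

open MeasureTheory ProbabilityTheory

noncomputable section

namespace Granularity

/-- The lower `α`-quantile `inf {y ∈ ℝ : P[Y ≤ y] ≥ α}` of a random variable `Y`. -/
def quantile {Ω : Type*} [MeasurableSpace Ω] (P : Measure Ω) (α : ℝ) (Y : Ω → ℝ) : ℝ :=
  sInf {y : ℝ | α ≤ P.real {ω | Y ω ≤ y}}

/-- The distribution function of the standard normal distribution. -/
def Phi (x : ℝ) : ℝ := cdf (gaussianReal 0 1) x

/-- The density of the standard normal distribution. -/
def phi (x : ℝ) : ℝ := gaussianPDFReal 0 1 x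

/-- The default event `{√ρ X + √(1-ρ) ξ ≤ c}` of a single asset. -/
def defaultEvent {Ω : Type*} (ρ c : ℝ) (X ξ : Ω → ℝ) : Set Ω :=
  {ω | √ρ * X ω + √(1 - ρ) * ξ ω ≤ c}

/-- The portfolio loss `L_n = ∑ u_i 1_{D_i}`. -/
def portfolioLoss {Ω : Type*} {n : ℕ} (u ρ c : Fin n → ℝ) (X : Ω → ℝ) (ξ : Fin n → Ω → ℝ)
    (ω : Ω) : ℝ :=
  ∑ i, u i * (defaultEvent (ρ i) (c i) X (ξ i)).indicator (fun _ => (1 : ℝ)) ω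

/-- The threshold `(c - √ρ x) / √(1-ρ)`. -/
def threshold (ρ c x : ℝ) : ℝ := (c - √ρ * x) / √(1 - ρ)

/-- The function `g_n(x) = ∑ u_i Φ((c_i - √ρ_i x) / √(1-ρ_i))`. -/
def condLoss {n : ℕ} (u ρ c : Fin n → ℝ) (x : ℝ) : ℝ :=
  ∑ i, u i * Phi (threshold (ρ i) (c i) x)

/-- The conditional expectation `E[L | X]`. -/
def systematicPart {Ω : Type*} [MeasurableSpace Ω] (P : Measure Ω) (L X : Ω → ℝ) : Ω → ℝ :=
  P[L | MeasurableSpace.comap X inferInstance]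

/-- The function `h ↦ q_α(E[L | X] + h (L - E[L | X]))`; its value at `h = 1` is `q_α(L)`. -/
def quantilePath {Ω : Type*} [MeasurableSpace Ω] (P : Measure Ω) (α : ℝ) (L X : Ω → ℝ)
    (h : ℝ) : ℝ :=
  quantile P α
    (fun ω => systematicPart P L X ω + h * (L ω - systematicPart P L X ω))

/-- The second order Taylor polynomial of `Q` around `0`, evaluated at `1`. -/
def taylorTwo (Q : ℝ → ℝ) : ℝ :=
  Q 0 + deriv Q 0 + 1 / 2 * deriv (deriv Q) 0

end Granularity

end

namespace Granularity

open Set Filter Topology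

/-! Given `X = x` the defaults are independent, so the portfolio is described by its finite default
pattern `S`, of conditional probability `w_S(x)`, on which the loss is the constant `l_S = ∑ i ∈ S,
u i`. On this pattern the path variable is `(1 - h) g(X) + h l_S`. Since `g` is strictly decreasing,
for `h < 1` it is at most `y` exactly when `X ≥ x_S`, where `y = (1 - h) g(x_S) + h l_S`, whenever
such a point `x_S` exists. The distribution function is then a finite sum of smooth tail integrals
`I_S(x_S)` with `I_S' = -w_S φ` (`measureReal_path_le`, `path_sublevel_eq_Ici`).

At `h = 0` all `x_S` equal `z`, and the `y`-derivative of the sum is `-φ(z) / g'(z) ≠ 0`. The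
implicit function theorem gives a `C²` root `q(h)` of `∑ I_S(x_S) = α`, and monotonicity of the
distribution function makes this root the quantile (`exists_local_root_of_pattern_sum`).

Differentiating the two relations twice at `0` gives `Q'(0) = 0` and expresses `Q''(0)` through `∑
w_S (g(z) - l_S)²` and `∑ w_S' (g(z) - l_S)²` (`implicit_first_second_deriv`). The first sum is the
conditional variance of the loss, the second its derivative in `x` at `z`; the moment identities for
`patternProb` evaluate both. -/

theorem hasDerivAt_integral_Iic {f : ℝ → ℝ} (hf : Continuous f) (hi : Integrable f) (a : ℝ) :
    HasDerivAt (fun b => ∫ x in Iic b, f x) (f a) a := by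
  have h : (fun b => ∫ x in Iic b, f x) = fun b => (∫ x in Iic a, f x) + ∫ x in a..b, f x := by
    funext b
    rw [← intervalIntegral.integral_Iic_sub_Iic hi.integrableOn hi.integrableOn]
    ring
  rw [h]
  exact (intervalIntegral.integral_hasDerivAt_right (hf.intervalIntegrable _ _)
    (hf.stronglyMeasurableAtFilter _ _) hf.continuousAt).const_add _

theorem hasDerivAt_integral_Ici {f : ℝ → ℝ} (hf : Continuous f) (hi : Integrable f) (a : ℝ) :
    HasDerivAt (fun b => ∫ x in Ici b, f x) (-f a) a := by
  have h : (fun b => ∫ x in Ici b, f x) = fun b => (∫ x, f x) - ∫ x in Iic b, f x := by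
    funext b
    rw [integral_Ici_eq_integral_Ioi,
      ← intervalIntegral.integral_Iic_add_Ioi (b := b) hi.integrableOn hi.integrableOn]
    ring
  rw [h]
  exact (hasDerivAt_integral_Iic hf hi a).const_sub _

theorem contDiff_two_of_hasDerivAt {f f' : ℝ → ℝ} (h : ∀ x, HasDerivAt f (f' x) x)
    (hf' : ContDiff ℝ 1 f') : ContDiff ℝ 2 f := by
  have h2 : (2 : WithTop ℕ∞) = 1 + 1 := by norm_num
  rw [h2, contDiff_succ_iff_deriv]
  refine ⟨fun x => (h x).differentiableAt, by simp, ?_⟩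
  rwa [show deriv f = f' from funext fun x => (h x).deriv]

/-! ### Standard normal density, distribution function and quantiles. -/

theorem phi_eq (x : ℝ) : phi x = (√(2 * Real.pi))⁻¹ * Real.exp (-(x ^ 2) / 2) := by
  simp [phi, gaussianPDFReal]

theorem phi_pos (x : ℝ) : 0 < phi x := gaussianPDFReal_pos 0 1 x one_ne_zero

theorem hasDerivAt_phi (x : ℝ) : HasDerivAt phi (-x * phi x) x := by
  have h : phi = fun x => (√(2 * Real.pi))⁻¹ * Real.exp (-(x ^ 2) / 2) := funext phi_eq
  rw [h]
  have := ((((hasDerivAt_id x).pow 2).neg.div_const 2).exp).const_mul (√(2 * Real.pi))⁻¹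
  refine this.congr_deriv ?_
  simp only [Pi.neg_apply, Pi.pow_apply, id, Nat.cast_ofNat]
  ring

theorem contDiff_phi {k : WithTop ℕ∞} : ContDiff ℝ k phi := by
  have h : phi = fun x => (√(2 * Real.pi))⁻¹ * Real.exp (-(x ^ 2) / 2) := funext phi_eq
  rw [h]
  fun_prop

theorem integrable_phi : Integrable phi := integrable_gaussianPDFReal 0 1

theorem setIntegral_gaussian (w : ℝ → ℝ) (s : Set ℝ) (hs : MeasurableSet s) :
    ∫ x in s, w x ∂(gaussianReal 0 1) = ∫ x in s, w x * phi x := by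
  rw [← integral_indicator hs, integral_gaussianReal_eq_integral_smul one_ne_zero,
    ← integral_indicator hs]
  congr 1
  funext x
  by_cases hx : x ∈ s <;> simp [hx, phi, mul_comm]

theorem hasDerivAt_Phi (x : ℝ) : HasDerivAt Phi (phi x) x := by
  have h : Phi = fun b => ∫ x in Iic b, phi x := by
    funext b
    have := setIntegral_gaussian (fun _ => 1) (Iic b) measurableSet_Iic
    simp only [one_mul] at this
    rw [← this, Phi, cdf_eq_real]
    simp
  rw [h]
  exact hasDerivAt_integral_Iic (contDiff_phi (k := 0)).continuous integrable_phi x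

theorem contDiff_Phi : ContDiff ℝ 2 Phi := contDiff_two_of_hasDerivAt hasDerivAt_Phi contDiff_phi

theorem Phi_nonneg (x : ℝ) : 0 ≤ Phi x := cdf_nonneg _ x

theorem Phi_le_one (x : ℝ) : Phi x ≤ 1 := cdf_le_one _ x

theorem strictMono_Phi : StrictMono Phi :=
  strictMono_of_hasDerivAt_pos hasDerivAt_Phi phi_pos

theorem exists_Phi_eq {β : ℝ} (h0 : 0 < β) (h1 : β < 1) : ∃ x, Phi x = β :=
  mem_range_of_exists_le_of_exists_ge contDiff_Phi.continuous
    (((tendsto_cdf_atBot (gaussianReal 0 1)).eventually (ge_mem_nhds h0)).exists)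
    (((tendsto_cdf_atTop (gaussianReal 0 1)).eventually (le_mem_nhds h1)).exists)

theorem quantile_eq_of_forall {Ω : Type*} [MeasurableSpace Ω] {P : Measure Ω} {α y : ℝ}
    {Y : Ω → ℝ} (hy : α ≤ P.real {ω | Y ω ≤ y})
    (hlt : ∀ y', α ≤ P.real {ω | Y ω ≤ y'} → y ≤ y') : quantile P α Y = y :=
  IsLeast.csInf_eq ⟨hy, hlt⟩

theorem Phi_quantile {Ω : Type*} [MeasurableSpace Ω] {P : Measure Ω} {X : Ω → ℝ}
    (hX : Measurable X) (hlaw : P.map X = gaussianReal 0 1) {β : ℝ} (h0 : 0 < β) (h1 : β < 1) :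
    Phi (quantile P β X) = β := by
  obtain ⟨x, hx⟩ := exists_Phi_eq h0 h1
  have hP : ∀ y, P.real {ω | X ω ≤ y} = Phi y := by
    intro y
    rw [Phi, cdf_eq_real, ← hlaw, map_measureReal_apply hX measurableSet_Iic]
    rfl
  rw [quantile_eq_of_forall (y := x) (by rw [hP, hx]), hx]
  intro y' hy'
  rw [hP, ← hx] at hy'
  exact strictMono_Phi.le_iff_le.1 hy'

/-! ### Moments of a weighted sum of independent Bernoulli variables, as finite sums over patterns.
-/

/-- The probability that exactly the members of `S` occur, for independent events of
probabilities `p i`. -/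
noncomputable def patternProb {ι : Type*} [Fintype ι] [DecidableEq ι] (p : ι → ℝ)
    (S : Finset ι) : ℝ :=
  ∏ i, if i ∈ S then p i else 1 - p i

section Pattern

variable {ι : Type*} [Fintype ι] [DecidableEq ι]

theorem sum_prod_ite_mem (a b : ι → ℝ) :
    ∑ S : Finset ι, ∏ i, (if i ∈ S then a i else b i) = ∏ i, (a i + b i) := by
  rw [Finset.prod_add, Finset.powerset_univ]
  refine Finset.sum_congr rfl fun S _ => ?_
  rw [Finset.prod_ite]
  congr 1
  · simp
  · congr 1; ext; simp

/-- Replacing `1 - p i` by `0` for `i ∈ T` kills every pattern that misses a point of `T` and leaves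
the others unchanged. The expanded product then has factor `p i` on `T` and `p i + (1 - p i) = 1`
elsewhere. -/
theorem sum_patternProb_superset (p : ι → ℝ) (T : Finset ι) :
    ∑ S : Finset ι, patternProb p S * (if T ⊆ S then 1 else 0) = ∏ i ∈ T, p i := by
  have h := sum_prod_ite_mem p (fun i => if i ∈ T then 0 else 1 - p i)
  have h2 : ∏ i, (p i + if i ∈ T then 0 else 1 - p i) = ∏ i ∈ T, p i := by
    rw [← Finset.prod_subset (Finset.subset_univ T)]
    · exact Finset.prod_congr rfl fun i hi => by simp [hi]
    · intro i _ hi; simp [hi]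
  rw [← h2, ← h]
  refine Finset.sum_congr rfl fun S _ => ?_
  split_ifs with hTS
  · rw [mul_one]
    refine Finset.prod_congr rfl fun i _ => ?_
    by_cases hi : i ∈ S
    · simp [hi]
    · have : i ∉ T := fun h => hi (hTS h)
      simp [hi, this]
  · obtain ⟨i, hiT, hiS⟩ := Finset.not_subset.1 hTS
    rw [mul_zero, eq_comm]
    exact Finset.prod_eq_zero (Finset.mem_univ i) (by simp [hiT, hiS])

theorem sum_patternProb (p : ι → ℝ) : ∑ S : Finset ι, patternProb p S = 1 := by
  simpa using sum_patternProb_superset p ∅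

theorem sum_patternProb_mul_sum (p u : ι → ℝ) :
    ∑ S : Finset ι, patternProb p S * ∑ i ∈ S, u i = ∑ i, u i * p i := by
  have h : ∀ S : Finset ι, ∑ i ∈ S, u i = ∑ i, u i * (if ({i} : Finset ι) ⊆ S then 1 else 0) := by
    intro S; simp
  simp_rw [h, Finset.mul_sum]
  rw [Finset.sum_comm]
  refine Finset.sum_congr rfl fun i _ => ?_
  have := sum_patternProb_superset p {i}
  rw [Finset.prod_singleton] at this
  rw [← this, Finset.mul_sum]
  exact Finset.sum_congr rfl fun S _ => by ring

theorem sum_patternProb_mul_sum_sq (p u : ι → ℝ) :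
    ∑ S : Finset ι, patternProb p S * (∑ i ∈ S, u i) ^ 2 =
      (∑ i, u i * p i) ^ 2 + ∑ i, u i ^ 2 * (p i - p i ^ 2) := by
  have h : ∀ S : Finset ι, (∑ i ∈ S, u i) ^ 2 =
      ∑ i, ∑ j, u i * u j * (if ({i, j} : Finset ι) ⊆ S then 1 else 0) := by
    intro S
    have h1 : ∑ i ∈ S, u i = ∑ i, u i * (if i ∈ S then 1 else 0) := by simp
    rw [h1, sq, Finset.sum_mul_sum]
    refine Finset.sum_congr rfl fun i _ => Finset.sum_congr rfl fun j _ => ?_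
    by_cases hi : i ∈ S <;> by_cases hj : j ∈ S <;> simp [hi, hj, Finset.insert_subset_iff]
  have h2 : ∑ S : Finset ι, patternProb p S * (∑ i ∈ S, u i) ^ 2 =
      ∑ i, ∑ j, u i * u j * ∏ k ∈ ({i, j} : Finset ι), p k := by
    simp_rw [h, Finset.mul_sum]
    rw [Finset.sum_comm]
    refine Finset.sum_congr rfl fun i _ => ?_
    rw [Finset.sum_comm]
    refine Finset.sum_congr rfl fun j _ => ?_
    rw [← sum_patternProb_superset, Finset.mul_sum]
    exact Finset.sum_congr rfl fun S _ => by ring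
  rw [h2, sq, Finset.sum_mul_sum, ← Finset.sum_add_distrib]
  refine Finset.sum_congr rfl fun i _ => ?_
  -- On the diagonal `{i, i}` is a singleton and contributes `p i` instead of `p i ^ 2`; the excess
  -- is the variance term.
  have h3 : ∀ j, u i * u j * ∏ k ∈ ({i, j} : Finset ι), p k =
      u i * p i * (u j * p j) + if i = j then u i ^ 2 * (p i - p i ^ 2) else 0 := by
    intro j
    by_cases hij : i = j
    · subst hij; simp; ring
    · rw [Finset.prod_pair hij]; simp [hij]; ring
  simp_rw [h3, Finset.sum_add_distrib]
  simp

/-- The centre `y` is kept free: the variance uses `y` equal to the mean, while its derivative is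
taken with `y` frozen and `p` moving. -/
theorem sum_patternProb_mul_sub_sq (p u : ι → ℝ) (y : ℝ) :
    ∑ S : Finset ι, patternProb p S * (y - ∑ i ∈ S, u i) ^ 2 =
      (y - ∑ i, u i * p i) ^ 2 + ∑ i, u i ^ 2 * (p i - p i ^ 2) := by
  have h : ∀ S : Finset ι, patternProb p S * (y - ∑ i ∈ S, u i) ^ 2 =
      y ^ 2 * patternProb p S - 2 * y * (patternProb p S * ∑ i ∈ S, u i) +
        patternProb p S * (∑ i ∈ S, u i) ^ 2 := fun S => by ring
  simp_rw [h, Finset.sum_add_distrib, Finset.sum_sub_distrib, ← Finset.mul_sum]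
  rw [sum_patternProb, sum_patternProb_mul_sum, sum_patternProb_mul_sum_sq]
  ring

theorem patternProb_nonneg {p : ι → ℝ} (h0 : ∀ i, 0 ≤ p i) (h1 : ∀ i, p i ≤ 1) (S : Finset ι) :
    0 ≤ patternProb p S :=
  Finset.prod_nonneg fun i _ => by
    split_ifs
    · exact h0 i
    · exact sub_nonneg.2 (h1 i)

theorem patternProb_le_one {p : ι → ℝ} (h0 : ∀ i, 0 ≤ p i) (h1 : ∀ i, p i ≤ 1) (S : Finset ι) :
    patternProb p S ≤ 1 :=
  Finset.prod_le_one
    (fun i _ => by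
      split_ifs
      · exact h0 i
      · exact sub_nonneg.2 (h1 i))
    (fun i _ => by
      split_ifs
      · exact h1 i
      · linarith [h0 i])

theorem contDiff_patternProb {k : WithTop ℕ∞} {p : ι → ℝ → ℝ} (hp : ∀ i, ContDiff ℝ k (p i))
    (S : Finset ι) : ContDiff ℝ k fun x => patternProb (fun i => p i x) S := by
  unfold patternProb
  refine contDiff_prod fun i _ => ?_
  split_ifs
  · exact hp i
  · exact contDiff_const.sub (hp i)

end Pattern

/-! ### The loss as a function of the default pattern. -/

section Pattern

variable {Ω : Type*} {n : ℕ} {X : Ω → ℝ} {ξ : Fin n → Ω → ℝ}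

open Classical in
/-- The set of assets in default. -/
noncomputable def defaultPattern (ρ c : Fin n → ℝ) (X : Ω → ℝ) (ξ : Fin n → Ω → ℝ) (ω : Ω) :
    Finset (Fin n) :=
  Finset.univ.filter fun i => ω ∈ defaultEvent (ρ i) (c i) X (ξ i)

theorem mem_defaultPattern {ρ c : Fin n → ℝ} {ω : Ω} {i : Fin n} :
    i ∈ defaultPattern ρ c X ξ ω ↔ ω ∈ defaultEvent (ρ i) (c i) X (ξ i) := by
  simp [defaultPattern]

theorem portfolioLoss_eq (u ρ c : Fin n → ℝ) (ω : Ω) :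
    portfolioLoss u ρ c X ξ ω = ∑ i ∈ defaultPattern ρ c X ξ ω, u i := by
  classical
  simp [portfolioLoss, defaultPattern, Finset.sum_filter, indicator_apply]

end Pattern

/-! ### Laws in the one-factor model: conditioning on `X`. -/

section Model

variable {Ω : Type*} [MeasurableSpace Ω] {P : Measure Ω} [IsProbabilityMeasure P] {n : ℕ}
  {X : Ω → ℝ} {ξ : Fin n → Ω → ℝ}

theorem map_prod_pi_eq (hX : Measurable X) (hξ : ∀ i, Measurable (ξ i))
    (hXl : P.map X = gaussianReal 0 1) (hξl : ∀ i, P.map (ξ i) = gaussianReal 0 1)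
    (hind : iIndepFun (fun k : Option (Fin n) => k.elim X ξ) P) :
    P.map (fun ω => (X ω, fun i => ξ i ω)) =
      (gaussianReal 0 1).prod (Measure.pi fun _ : Fin n => gaussianReal 0 1) := by
  have hm : ∀ k : Option (Fin n), Measurable (k.elim X ξ) := by
    rintro (_ | i)
    · exact hX
    · exact hξ i
  have h1 : iIndepFun ξ P := hind.precomp (g := some) (Option.some_injective (Fin n))
  have h2 := hind.indepFun_finset {none} (Finset.univ.map Function.Embedding.some)
    (by simp) hm
  have h3 : IndepFun X (fun ω i => ξ i ω) P := by
    have hf : Measurable fun v : (({none} : Finset (Option (Fin n))) → ℝ) =>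
        v ⟨none, by simp⟩ := measurable_pi_apply _
    have hg : Measurable fun v : (((Finset.univ : Finset (Fin n)).map Function.Embedding.some :
        Finset (Option (Fin n))) → ℝ) => fun i : Fin n => v ⟨some i, by simp⟩ :=
      measurable_pi_lambda _ fun i => measurable_pi_apply _
    exact h2.comp hf hg
  rw [(indepFun_iff_map_prod_eq_prod_map_map hX.aemeasurable
    (measurable_pi_lambda _ hξ).aemeasurable).1 h3, hXl,
    h1.map_fun_eq_pi_map fun i => (hξ i).aemeasurable]
  simp_rw [hξl]

/-- Fubini for the product law of `(X, ξ)`: the section of the event at a point `x ∈ B` is a box,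
whose product measure factorises. -/
theorem measureReal_inter_forall (hX : Measurable X) (hξ : ∀ i, Measurable (ξ i))
    (hXl : P.map X = gaussianReal 0 1) (hξl : ∀ i, P.map (ξ i) = gaussianReal 0 1)
    (hind : iIndepFun (fun k : Option (Fin n) => k.elim X ξ) P)
    {B : Set ℝ} (hB : MeasurableSet B) {A : Fin n → Set (ℝ × ℝ)} (hA : ∀ i, MeasurableSet (A i)) :
    P.real {ω | X ω ∈ B ∧ ∀ i, (X ω, ξ i ω) ∈ A i} =
      ∫ x in B, ∏ i, (gaussianReal 0 1).real (Prod.mk x ⁻¹' A i) ∂(gaussianReal 0 1) := by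
  set γ := gaussianReal 0 1
  let E : Set (ℝ × (Fin n → ℝ)) := {p | p.1 ∈ B ∧ ∀ i, (p.1, p.2 i) ∈ A i}
  have hE : MeasurableSet E := by
    have : E = (Prod.fst ⁻¹' B) ∩ ⋂ i, (fun p : ℝ × (Fin n → ℝ) => (p.1, p.2 i)) ⁻¹' A i := by
      ext p; simp [E]
    rw [this]
    refine (measurable_fst hB).inter (MeasurableSet.iInter fun i => ?_)
    exact (measurable_fst.prodMk ((measurable_pi_apply i).comp measurable_snd)) (hA i)
  have hmeas : Measurable fun ω => (X ω, fun i => ξ i ω) :=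
    hX.prodMk (measurable_pi_lambda _ hξ)
  have h1 : P.real {ω | X ω ∈ B ∧ ∀ i, (X ω, ξ i ω) ∈ A i} =
      (γ.prod (Measure.pi fun _ : Fin n => γ)).real E := by
    rw [← map_prod_pi_eq hX hξ hXl hξl hind, map_measureReal_apply hmeas hE]
    rfl
  have hsec : ∀ x, (Measure.pi fun _ : Fin n => γ) (Prod.mk x ⁻¹' E) =
      B.indicator (fun x => ∏ i, γ (Prod.mk x ⁻¹' A i)) x := by
    intro x
    by_cases hx : x ∈ B
    · rw [indicator_of_mem hx, ← Measure.pi_pi]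
      congr 1
      ext v
      simp [E, hx]
    · rw [indicator_of_notMem hx]
      have : Prod.mk x ⁻¹' E = ∅ := by ext v; simp [E, hx]
      rw [this, measure_empty]
  rw [h1, Measure.real, Measure.prod_apply hE]
  simp_rw [hsec]
  rw [lintegral_indicator hB, integral_eq_lintegral_of_nonneg_ae]
  · congr 1
    refine lintegral_congr fun x => ?_
    rw [ENNReal.ofReal_prod_of_nonneg fun i _ => measureReal_nonneg]
    exact Finset.prod_congr rfl fun i _ => by simp [Measure.real]
  · exact Eventually.of_forall fun x => Finset.prod_nonneg fun i _ => measureReal_nonneg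
  · refine (Finset.measurable_prod _ fun i _ => ?_).aestronglyMeasurable
    exact (measurable_measure_prodMk_left (hA i)).ennreal_toReal

theorem threshold_set_eq {ρ c : ℝ} (hρ : ρ < 1) (x : ℝ) :
    {e : ℝ | √ρ * x + √(1 - ρ) * e ≤ c} = Iic (threshold ρ c x) := by
  have h : 0 < √(1 - ρ) := Real.sqrt_pos.2 (sub_pos.2 hρ)
  ext e
  rw [mem_Iic, threshold, le_div_iff₀ h, mem_ofPred_eq]
  constructor <;> intro h <;> linarith

theorem measurableSet_default (ρ c : ℝ) :
    MeasurableSet {p : ℝ × ℝ | √ρ * p.1 + √(1 - ρ) * p.2 ≤ c} :=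
  measurableSet_le (by fun_prop) measurable_const

theorem measurableSet_defaultEvent (ρ c : ℝ) {Y Z : Ω → ℝ} (hY : Measurable Y)
    (hZ : Measurable Z) : MeasurableSet (defaultEvent ρ c Y Z) :=
  measurableSet_le (by fun_prop) measurable_const

theorem measureReal_defaultPattern (hX : Measurable X) (hξ : ∀ i, Measurable (ξ i))
    (hXl : P.map X = gaussianReal 0 1) (hξl : ∀ i, P.map (ξ i) = gaussianReal 0 1)
    (hind : iIndepFun (fun k : Option (Fin n) => k.elim X ξ) P) {ρ : Fin n → ℝ}
    (hρ : ∀ i, ρ i < 1) (c : Fin n → ℝ) {B : Set ℝ} (hB : MeasurableSet B) (S : Finset (Fin n)) :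
    P.real {ω | X ω ∈ B ∧ defaultPattern ρ c X ξ ω = S} =
      ∫ x in B, patternProb (fun i => Phi (threshold (ρ i) (c i) x)) S ∂(gaussianReal 0 1) := by
  let D : Fin n → Set (ℝ × ℝ) := fun i => {p | √(ρ i) * p.1 + √(1 - ρ i) * p.2 ≤ c i}
  have hD : ∀ i, MeasurableSet (D i) := fun i => measurableSet_default _ _
  let A : Fin n → Set (ℝ × ℝ) := fun i => if i ∈ S then D i else (D i)ᶜ
  have hA : ∀ i, MeasurableSet (A i) := by
    intro i
    simp only [A]
    split_ifs
    · exact hD i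
    · exact (hD i).compl
  have h1 : {ω | X ω ∈ B ∧ defaultPattern ρ c X ξ ω = S} =
      {ω | X ω ∈ B ∧ ∀ i, (X ω, ξ i ω) ∈ A i} := by
    ext ω
    simp only [mem_ofPred_eq, Finset.ext_iff, mem_defaultPattern]
    refine and_congr_right fun _ => forall_congr' fun i => ?_
    by_cases hi : i ∈ S <;> simp [A, D, hi, defaultEvent]
  have hsec : ∀ x i, (gaussianReal 0 1).real (Prod.mk x ⁻¹' D i) =
      Phi (threshold (ρ i) (c i) x) := by
    intro x i
    rw [Phi, cdf_eq_real, ← threshold_set_eq (hρ i)]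
    rfl
  rw [h1, measureReal_inter_forall hX hξ hXl hξl hind hB hA]
  congr 1
  funext x
  refine Finset.prod_congr rfl fun i _ => ?_
  simp only [A]
  split_ifs
  · exact hsec x i
  · rw [preimage_compl, probReal_compl_eq_one_sub (measurable_prodMk_left (hD i)), hsec]

theorem measureReal_inter_defaultEvent (hX : Measurable X) (hξ : ∀ i, Measurable (ξ i))
    (hXl : P.map X = gaussianReal 0 1) (hξl : ∀ i, P.map (ξ i) = gaussianReal 0 1)
    (hind : iIndepFun (fun k : Option (Fin n) => k.elim X ξ) P) {ρ c : ℝ} (hρ : ρ < 1)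
    {B : Set ℝ} (hB : MeasurableSet B) (i : Fin n) :
    P.real (defaultEvent ρ c X (ξ i) ∩ X ⁻¹' B) =
      ∫ x in B, Phi (threshold ρ c x) ∂(gaussianReal 0 1) := by
  let D : Set (ℝ × ℝ) := {p | √ρ * p.1 + √(1 - ρ) * p.2 ≤ c}
  let A : Fin n → Set (ℝ × ℝ) := fun j => if j = i then D else univ
  have hA : ∀ i, MeasurableSet (A i) := by
    intro i
    simp only [A]
    split_ifs
    · exact measurableSet_default _ _
    · exact MeasurableSet.univ
  have h1 : defaultEvent ρ c X (ξ i) ∩ X ⁻¹' B = {ω | X ω ∈ B ∧ ∀ j, (X ω, ξ j ω) ∈ A j} := by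
    ext ω
    rw [inter_comm]
    refine and_congr_right fun _ => ?_
    constructor
    · intro h j
      by_cases hj : j = i
      · subst hj; simpa [A, D, defaultEvent] using h
      · simp [A, hj]
    · intro h
      simpa [A, D, defaultEvent] using h i
  rw [h1, measureReal_inter_forall hX hξ hXl hξl hind hB hA]
  congr 1
  funext x
  rw [Finset.prod_eq_single i]
  · rw [Phi, cdf_eq_real, ← threshold_set_eq hρ]
    simp [A, D]
  · intro j _ hj
    simp [A, hj]
  · simp

theorem contDiff_threshold {k : WithTop ℕ∞} (ρ c : ℝ) : ContDiff ℝ k (threshold ρ c) := by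
  unfold threshold
  fun_prop

theorem contDiff_condProb (ρ c : ℝ) : ContDiff ℝ 2 fun x => Phi (threshold ρ c x) :=
  contDiff_Phi.comp (contDiff_threshold ρ c)

theorem contDiff_condLoss (u ρ c : Fin n → ℝ) : ContDiff ℝ 2 (condLoss u ρ c) := by
  unfold condLoss
  exact ContDiff.sum fun i _ => contDiff_const.mul (contDiff_condProb _ _)

theorem integrable_condProb (μ : Measure ℝ) [IsFiniteMeasure μ] (ρ c : ℝ) :
    Integrable (fun x => Phi (threshold ρ c x)) μ :=
  Integrable.of_bound (contDiff_condProb ρ c).continuous.aestronglyMeasurable 1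
    (Eventually.of_forall fun x => by
      rw [Real.norm_eq_abs, abs_of_nonneg (Phi_nonneg _)]; exact Phi_le_one _)

theorem integrable_condLoss (μ : Measure ℝ) [IsFiniteMeasure μ] (u ρ c : Fin n → ℝ) :
    Integrable (condLoss u ρ c) μ := by
  unfold condLoss
  exact integrable_finsetSum _ fun i _ => (integrable_condProb μ _ _).const_mul _

/-- Conditional expectations are characterised by integrals over the sets `X ⁻¹' B`; by linearity it
suffices to compare them for a single default event. -/
theorem systematicPart_ae_eq (hX : Measurable X) (hξ : ∀ i, Measurable (ξ i))
    (hXl : P.map X = gaussianReal 0 1) (hξl : ∀ i, P.map (ξ i) = gaussianReal 0 1)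
    (hind : iIndepFun (fun k : Option (Fin n) => k.elim X ξ) P) (u c : Fin n → ℝ)
    {ρ : Fin n → ℝ} (hρ : ∀ i, ρ i < 1) :
    systematicPart P (portfolioLoss u ρ c X ξ) X =ᵐ[P] fun ω => condLoss u ρ c (X ω) := by
  have hgi : Integrable (fun ω => condLoss u ρ c (X ω)) P := by
    refine Integrable.comp_measurable (g := condLoss u ρ c) ?_ hX
    rw [hXl]
    exact integrable_condLoss _ _ _ _
  have hDi : ∀ i, MeasurableSet (defaultEvent (ρ i) (c i) X (ξ i)) := fun i =>
    measurableSet_defaultEvent _ _ hX (hξ i)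
  have hIi : ∀ i, Integrable (fun ω =>
      u i * (defaultEvent (ρ i) (c i) X (ξ i)).indicator (fun _ => (1 : ℝ)) ω) P := fun i =>
    ((integrable_const (1 : ℝ)).indicator (hDi i)).const_mul _
  have hLi : Integrable (portfolioLoss u ρ c X ξ) P := by
    unfold portfolioLoss
    exact integrable_finsetSum _ fun i _ => hIi i
  refine (ae_eq_condExp_of_forall_setIntegral_eq hX.comap_le hLi
    (fun s _ _ => hgi.integrableOn) ?_ ?_).symm
  · rintro _ ⟨B, hB, rfl⟩ -
    have h1 : ∫ ω in X ⁻¹' B, condLoss u ρ c (X ω) ∂P =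
        ∫ x in B, condLoss u ρ c x ∂(gaussianReal 0 1) := by
      rw [← hXl, setIntegral_map hB
        (contDiff_condLoss u ρ c).continuous.aestronglyMeasurable hX.aemeasurable]
    rw [h1]
    unfold condLoss portfolioLoss
    rw [integral_finsetSum _ fun i _ => (integrable_condProb _ _ _).const_mul _,
      integral_finsetSum _ fun i _ => (hIi i).integrableOn]
    refine Finset.sum_congr rfl fun i _ => ?_
    rw [integral_const_mul, integral_const_mul,
      ← measureReal_inter_defaultEvent hX hξ hXl hξl hind (hρ i) hB i, integral_indicator (hDi i)]
    simp [measureReal_restrict_apply, hDi i]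
  · exact ((contDiff_condLoss u ρ c).continuous.measurable.comp
      (comap_measurable X)).aestronglyMeasurable

/-- Split over the default pattern: once it is fixed the loss is a constant, and the inequality
restricts `X` alone. -/
theorem measureReal_path_le (hX : Measurable X) (hξ : ∀ i, Measurable (ξ i))
    (hXl : P.map X = gaussianReal 0 1) (hξl : ∀ i, P.map (ξ i) = gaussianReal 0 1)
    (hind : iIndepFun (fun k : Option (Fin n) => k.elim X ξ) P) (u c : Fin n → ℝ)
    {ρ : Fin n → ℝ} (hρ : ∀ i, ρ i < 1) (h y : ℝ) :
    P.real {ω | systematicPart P (portfolioLoss u ρ c X ξ) X ω +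
        h * (portfolioLoss u ρ c X ξ ω -
          systematicPart P (portfolioLoss u ρ c X ξ) X ω) ≤ y} =
      ∑ S : Finset (Fin n),
        ∫ x in {x | condLoss u ρ c x + h * ((∑ i ∈ S, u i) - condLoss u ρ c x) ≤ y},
          patternProb (fun i => Phi (threshold (ρ i) (c i) x)) S * phi x := by
  let B : Finset (Fin n) → Set ℝ := fun S =>
    {x | condLoss u ρ c x + h * ((∑ i ∈ S, u i) - condLoss u ρ c x) ≤ y}
  have hB : ∀ S, MeasurableSet (B S) := by
    intro S
    have := (contDiff_condLoss u ρ c).continuous.measurable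
    exact measurableSet_le (by fun_prop) measurable_const
  have hmeas : ∀ S, MeasurableSet {ω | X ω ∈ B S ∧ defaultPattern ρ c X ξ ω = S} := by
    intro S
    have : {ω | X ω ∈ B S ∧ defaultPattern ρ c X ξ ω = S} = X ⁻¹' B S ∩ ⋂ i,
        {ω | ω ∈ defaultEvent (ρ i) (c i) X (ξ i) ↔ i ∈ S} := by
      ext ω
      simp [Finset.ext_iff, mem_defaultPattern]
    rw [this]
    refine (hX (hB S)).inter (MeasurableSet.iInter fun i => ?_)
    have hD := measurableSet_defaultEvent (ρ i) (c i) hX (hξ i)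
    by_cases hi : i ∈ S
    · simp only [hi, iff_true]
      exact hD
    · simp only [hi, iff_false]
      exact hD.compl
  have h1 : P.real {ω | systematicPart P (portfolioLoss u ρ c X ξ) X ω +
        h * (portfolioLoss u ρ c X ξ ω -
          systematicPart P (portfolioLoss u ρ c X ξ) X ω) ≤ y} =
      P.real (⋃ S, {ω | X ω ∈ B S ∧ defaultPattern ρ c X ξ ω = S}) := by
    refine measureReal_congr ?_
    filter_upwards [systematicPart_ae_eq hX hξ hXl hξl hind u c hρ] with ω hω
    refine propext ?_
    change (_ ≤ y) ↔ ω ∈ ⋃ S, {ω | X ω ∈ B S ∧ defaultPattern ρ c X ξ ω = S}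
    rw [hω, portfolioLoss_eq]
    simp [B]
  rw [h1, measureReal_iUnion_fintype _ hmeas]
  · refine Finset.sum_congr rfl fun S _ => ?_
    rw [measureReal_defaultPattern hX hξ hXl hξl hind hρ c (hB S),
      setIntegral_gaussian _ _ (hB S)]
  · intro S T hST
    refine disjoint_left.2 fun ω h1 h2 => hST ?_
    rw [← h1.2, ← h2.2]

end Model

/-! ### The implicit function argument and the derivatives of the quantile. -/

section Calculus

theorem eventually_hasDerivAt_of_contDiffAt_two {f : ℝ → ℝ} {a : ℝ} (hf : ContDiffAt ℝ 2 f a) :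
    (∀ᶠ h in 𝓝 a, HasDerivAt f (deriv f h) h) ∧ HasDerivAt (deriv f) (deriv (deriv f) a) a := by
  constructor
  · filter_upwards [hf.eventually (by simp)] with h hh
    exact (hh.differentiableAt (by simp)).hasDerivAt
  · have : ContDiffAt ℝ 1 (deriv f) a :=
      (hf.fderiv_right (m := 1) (by norm_num)).clm_apply contDiffAt_const
    exact (this.differentiableAt (by simp)).hasDerivAt

variable {ι : Type*} [Fintype ι] {g q : ℝ → ℝ} {w I x : ι → ℝ → ℝ} {l : ι → ℝ} {z α : ℝ}

/-- `q` does not depend on `S`, so each derivative of `q` may be averaged with the weights `w S z`.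
The averages of `x_S'(0)` and `x_S''(0)` that then appear are supplied by the derivatives of the
constant sum `∑ I_S(x_S)`. -/
theorem implicit_first_second_deriv (hg : ContDiff ℝ 2 g) (hg' : deriv g z ≠ 0)
    (hx : ∀ S, ContDiffAt ℝ 2 (x S) 0) (hx0 : ∀ S, x S 0 = z)
    (hq : ∀ S, ∀ᶠ h in 𝓝 (0 : ℝ), q h = (1 - h) * g (x S h) + h * l S)
    (hI : ∀ S a, HasDerivAt (I S) (-(w S a * phi a)) a) (hw : ∀ S, DifferentiableAt ℝ (w S) z)
    (hsum : ∀ᶠ h in 𝓝 (0 : ℝ), ∑ S, I S (x S h) = α)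
    (hw1 : ∑ S, w S z = 1) (hwl : ∑ S, w S z * (g z - l S) = 0) :
    deriv q 0 = 0 ∧ deriv (deriv q) 0 =
      ((z + deriv (deriv g) z / deriv g z) * (∑ S, w S z * (g z - l S) ^ 2) -
        ∑ S, deriv (w S) z * (g z - l S) ^ 2) / deriv g z := by
  have hgd : ∀ y, HasDerivAt g (deriv g y) y := fun y =>
    (hg.differentiable (by simp) y).hasDerivAt
  have hgd2 : HasDerivAt (deriv g) (deriv (deriv g) z) z :=
    (eventually_hasDerivAt_of_contDiffAt_two hg.contDiffAt).2
  have hxd := fun S => (eventually_hasDerivAt_of_contDiffAt_two (hx S)).1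
  have hxd2 := fun S => (eventually_hasDerivAt_of_contDiffAt_two (hx S)).2
  have hq1 : ∀ S, ∀ᶠ h in 𝓝 (0 : ℝ), deriv q h =
      (1 - h) * (deriv g (x S h) * deriv (x S) h) - g (x S h) + l S := by
    intro S
    filter_upwards [(hq S).eventually_nhds, hxd S] with h h1 h2
    have h3 := (((hasDerivAt_id h).const_sub 1).mul ((hgd (x S h)).comp h h2)).add
      ((hasDerivAt_id h).mul_const (l S))
    refine ((h3.congr_of_eventuallyEq (h1.mono fun _ hh => hh)).congr_deriv ?_).deriv
    simp only [id, Function.comp]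
    ring
  have hq2 : ∀ S, deriv (deriv q) 0 = deriv (deriv g) z * deriv (x S) 0 ^ 2 +
      deriv g z * deriv (deriv (x S)) 0 - 2 * deriv g z * deriv (x S) 0 := by
    intro S
    have hx1 := (hxd S).self_of_nhds
    have hgd2' : HasDerivAt (deriv g) (deriv (deriv g) z) (x S 0) := by rw [hx0]; exact hgd2
    have h3 := ((((hasDerivAt_id (0 : ℝ)).const_sub 1).mul
      ((hgd2'.comp 0 hx1).mul (hxd2 S))).sub ((hgd (x S 0)).comp 0 hx1)).add_const (l S)
    refine ((h3.congr_of_eventuallyEq ((hq1 S).mono fun _ hh => hh)).congr_deriv ?_).deriv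
    simp only [id, Function.comp, Pi.mul_apply, hx0]
    ring
  have hs1 : ∀ᶠ h in 𝓝 (0 : ℝ), ∑ S, -(w S (x S h) * phi (x S h)) * deriv (x S) h = 0 := by
    filter_upwards [hsum.eventually_nhds, eventually_all.2 hxd] with h h1 h2
    have h3 : HasDerivAt (fun h => ∑ S, I S (x S h))
        (∑ S, -(w S (x S h) * phi (x S h)) * deriv (x S) h) h :=
      HasDerivAt.fun_sum fun S _ => (hI S (x S h)).comp h (h2 S)
    exact h3.unique ((hasDerivAt_const h α).congr_of_eventuallyEq h1)
  have hs2 : ∑ S, (-(deriv (w S) z * phi z + w S z * (-z * phi z)) * deriv (x S) 0 ^ 2 +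
      -(w S z * phi z) * deriv (deriv (x S)) 0) = 0 := by
    have h3 : HasDerivAt (fun h => ∑ S, -(w S (x S h) * phi (x S h)) * deriv (x S) h)
        (∑ S, (-(deriv (w S) z * phi z + w S z * (-z * phi z)) * deriv (x S) 0 ^ 2 +
      -(w S z * phi z) * deriv (deriv (x S)) 0)) 0 := by
      refine HasDerivAt.fun_sum fun S _ => ?_
      have hx1 := (hxd S).self_of_nhds
      have hw' : HasDerivAt (w S) (deriv (w S) z) (x S 0) := by
        rw [hx0]; exact (hw S).hasDerivAt
      refine ((((hw'.mul (hasDerivAt_phi (x S 0))).neg).comp 0 hx1).mul (hxd2 S)).congr_deriv ?_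
      simp only [Function.comp, Pi.mul_apply, Pi.neg_apply, hx0]
      ring
    exact h3.unique ((hasDerivAt_const 0 0).congr_of_eventuallyEq hs1)
  have hphi := (phi_pos z).ne'
  have e3 : ∑ S, w S z * deriv (x S) 0 = 0 := by
    have h := hs1.self_of_nhds
    simp only [hx0] at h
    have h' : phi z * ∑ S, w S z * deriv (x S) 0 = 0 := by
      refine neg_eq_zero.1 (Eq.trans ?_ h)
      rw [Finset.mul_sum, ← Finset.sum_neg_distrib]
      exact Finset.sum_congr rfl fun S _ => by ring
    exact (mul_eq_zero.1 h').resolve_left hphi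
  have e4 : ∑ S, w S z * deriv (deriv (x S)) 0 =
      z * (∑ S, w S z * deriv (x S) 0 ^ 2) - ∑ S, deriv (w S) z * deriv (x S) 0 ^ 2 := by
    have h' : phi z * (∑ S, w S z * deriv (deriv (x S)) 0 -
        (z * (∑ S, w S z * deriv (x S) 0 ^ 2) - ∑ S, deriv (w S) z * deriv (x S) 0 ^ 2)) = 0 := by
      refine neg_eq_zero.1 (Eq.trans ?_ hs2)
      rw [Finset.mul_sum, ← Finset.sum_sub_distrib,
        ← Finset.sum_sub_distrib, Finset.mul_sum, ← Finset.sum_neg_distrib]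
      exact Finset.sum_congr rfl fun S _ => by ring
    exact sub_eq_zero.1 ((mul_eq_zero.1 h').resolve_left hphi)
  have e1 : ∀ S, deriv q 0 = deriv g z * deriv (x S) 0 - (g z - l S) := by
    intro S
    have := (hq1 S).self_of_nhds
    simp only [hx0] at this
    rw [this]
    ring
  have hq0 : deriv q 0 = 0 := by
    have : ∑ S, w S z * deriv q 0 = ∑ S, w S z * (deriv g z * deriv (x S) 0 - (g z - l S)) :=
      Finset.sum_congr rfl fun S _ => by rw [← e1 S]
    rw [← Finset.sum_mul, hw1, one_mul] at this
    rw [this]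
    have h2 : ∀ S, w S z * (deriv g z * deriv (x S) 0 - (g z - l S)) =
        deriv g z * (w S z * deriv (x S) 0) - w S z * (g z - l S) := fun S => by ring
    simp_rw [h2, Finset.sum_sub_distrib, ← Finset.mul_sum]
    rw [e3, hwl]
    ring
  -- As `q'(0) = 0`, this gives `x_S'(0) = (g z - l S) / g'(z)`, which turns squares of `x_S'(0)`
  -- into squared deviations of the loss.
  have e1' : ∀ S, g z - l S = deriv g z * deriv (x S) 0 := fun S => by
    have := e1 S
    linarith
  have hq2' : deriv (deriv q) 0 = deriv (deriv g) z * (∑ S, w S z * deriv (x S) 0 ^ 2) +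
      deriv g z * ∑ S, w S z * deriv (deriv (x S)) 0 := by
    have : ∑ S, w S z * deriv (deriv q) 0 = ∑ S, w S z * (deriv (deriv g) z * deriv (x S) 0 ^ 2 +
      deriv g z * deriv (deriv (x S)) 0 - 2 * deriv g z * deriv (x S) 0) :=
      Finset.sum_congr rfl fun S _ => by rw [← hq2 S]
    rw [← Finset.sum_mul, hw1, one_mul] at this
    rw [this]
    have h2 : ∀ S, w S z * (deriv (deriv g) z * deriv (x S) 0 ^ 2 +
        deriv g z * deriv (deriv (x S)) 0 - 2 * deriv g z * deriv (x S) 0) =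
        deriv (deriv g) z * (w S z * deriv (x S) 0 ^ 2) +
        deriv g z * (w S z * deriv (deriv (x S)) 0) -
        2 * deriv g z * (w S z * deriv (x S) 0) := fun S => by ring
    simp_rw [h2, Finset.sum_sub_distrib, Finset.sum_add_distrib, ← Finset.mul_sum]
    rw [e3]
    ring
  refine ⟨hq0, ?_⟩
  have h3 : ∀ c : ι → ℝ, ∑ S, c S * (g z - l S) ^ 2 =
      deriv g z ^ 2 * ∑ S, c S * deriv (x S) 0 ^ 2 := by
    intro c
    rw [Finset.mul_sum]
    exact Finset.sum_congr rfl fun S _ => by rw [e1' S]; ring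
  rw [hq2', e4, h3, h3]
  field_simp
  ring

theorem isInvertible_of_apply_one_ne_zero {T : ℝ →L[ℝ] ℝ} (hT : T 1 ≠ 0) : T.IsInvertible := by
  refine ⟨ContinuousLinearEquiv.unitsEquivAut ℝ (Units.mk0 (T 1) hT), ?_⟩
  ext
  simp

/-- `F` stands for the distribution function. Its formula is needed only where all the points `a S`
exist, since `y` may lie outside the range of `(1 - h) g + h l S`; near `(0, g z)` a local inverse
of `g` provides them. -/
theorem exists_local_root_of_pattern_sum (hg : ContDiff ℝ 2 g) (hg' : deriv g z ≠ 0)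
    (hI : ∀ S a, HasDerivAt (I S) (-(w S a * phi a)) a) (hI2 : ∀ S, ContDiff ℝ 2 (I S))
    (hw1 : ∑ S, w S z = 1) (hα : ∑ S, I S z = α) {F : ℝ → ℝ → ℝ}
    (hmono : ∀ h, Monotone (F h))
    (hF : ∀ (h y : ℝ) (a : ι → ℝ), h < 1 → (∀ S, y = (1 - h) * g (a S) + h * l S) →
      F h y = ∑ S, I S (a S)) :
    ∃ (q : ℝ → ℝ) (x : ι → ℝ → ℝ), q 0 = g z ∧ ContDiffAt ℝ 2 q 0 ∧
      (∀ S, ContDiffAt ℝ 2 (x S) 0) ∧ (∀ S, x S 0 = z) ∧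
      (∀ S, ∀ᶠ h in 𝓝 (0 : ℝ), q h = (1 - h) * g (x S h) + h * l S) ∧
      (∀ᶠ h in 𝓝 (0 : ℝ), ∑ S, I S (x S h) = α) ∧
      ∀ᶠ h in 𝓝 (0 : ℝ), IsLeast {y | α ≤ F h y} (q h) := by
  have hgz : HasDerivAt g (deriv g z) z := (hg.differentiable (by simp) z).hasDerivAt
  have hgf : HasFDerivAt g
      ((ContinuousLinearEquiv.unitsEquivAut ℝ (Units.mk0 _ hg') : ℝ ≃L[ℝ] ℝ) : ℝ →L[ℝ] ℝ) z := by
    refine hgz.hasFDerivAt.congr_fderiv ?_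
    ext
    simp
  let G : ℝ → ℝ := hg.contDiffAt.localInverse hgf (by simp)
  have hG : ContDiffAt ℝ 2 G (g z) := hg.contDiffAt.to_localInverse hgf (by simp)
  have hGz : G (g z) = z := hg.contDiffAt.localInverse_apply_image hgf (by simp)
  have hgG : ∀ᶠ v in 𝓝 (g z), g (G v) = v :=
    (hg.contDiffAt.hasStrictFDerivAt' hgf (by simp)).eventually_right_inverse
  have hGd : HasDerivAt G (deriv g z)⁻¹ (g z) := by
    refine HasDerivAt.of_local_left_inverse hG.continuousAt ?_ hg' hgG
    rw [hGz]; exact hgz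
  -- Solving `y = (1 - h) v + h l S` for the value `v` that `g` must take at `x_S`.
  let V : ι → ℝ × ℝ → ℝ := fun S p => (p.2 - p.1 * l S) / (1 - p.1)
  have hV0 : ∀ S, V S (0, g z) = g z := fun S => by simp [V]
  have hV : ∀ S, ContDiffAt ℝ 2 (V S) (0, g z) := fun S => by
    refine ContDiffAt.div (by fun_prop) (by fun_prop) (by simp)
  let x' : ι → ℝ × ℝ → ℝ := fun S p => G (V S p)
  have hx' : ∀ S, ContDiffAt ℝ 2 (x' S) (0, g z) := fun S => by
    refine ContDiffAt.comp (0, g z) (g := G) ?_ (hV S)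
    rw [hV0]; exact hG
  have hx'0 : ∀ S, x' S (0, g z) = z := fun S => by simp only [x', hV0, hGz]
  have hrel : ∀ᶠ p in 𝓝 ((0 : ℝ), g z), p.1 < 1 ∧
      ∀ S, p.2 = (1 - p.1) * g (x' S p) + p.1 * l S := by
    have h1 : ∀ᶠ p in 𝓝 ((0 : ℝ), g z), p.1 < 1 :=
      continuous_fst.continuousAt.eventually (gt_mem_nhds (by norm_num))
    have h2 : ∀ S, ∀ᶠ p in 𝓝 ((0 : ℝ), g z), g (G (V S p)) = V S p := fun S => by
      have h3 : ∀ᶠ v in 𝓝 (V S (0, g z)), g (G v) = v := by rw [hV0]; exact hgG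
      exact (hV S).continuousAt.eventually h3
    filter_upwards [h1, eventually_all.2 h2] with p hp1 hp2
    refine ⟨hp1, fun S => ?_⟩
    have : (1 : ℝ) - p.1 ≠ 0 := by linarith
    simp only [x', hp2, V]
    field_simp
    ring
  let K : ℝ × ℝ → ℝ := fun p => ∑ S, I S (x' S p)
  have hK : ContDiffAt ℝ 2 K (0, g z) :=
    ContDiffAt.sum fun S _ => (hI2 S).contDiffAt.comp _ (hx' S)
  have hK0 : K (0, g z) = α := by simp only [K, hx'0, hα]
  -- At `h = 0` every `x_S` is `G y`, and the weights sum to `1`, so the partial derivative in `y`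
  -- is `-φ(z) / g'(z)`.
  have hinv : (fderiv ℝ K (0, g z) ∘L .inr ℝ ℝ ℝ).IsInvertible := by
    refine isInvertible_of_apply_one_ne_zero ?_
    have h1 : HasDerivAt (fun y => K (0, y))
        ((fderiv ℝ K (0, g z) ∘L .inr ℝ ℝ ℝ) 1) (g z) := by
      have hin : HasFDerivAt (fun y : ℝ => ((0 : ℝ), y)) (.inr ℝ ℝ ℝ) (g z) :=
        hasFDerivAt_prodMk_right 0 (g z)
      exact ((hK.differentiableAt (by simp)).hasFDerivAt.comp (g z) hin).hasDerivAt
    have h2 : HasDerivAt (fun y => K (0, y))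
        (∑ S, -(w S z * phi z) * (deriv g z)⁻¹) (g z) := by
      have : (fun y => K (0, y)) = fun y => ∑ S, I S (G y) := by
        funext y; simp [K, x', V]
      rw [this]
      refine HasDerivAt.fun_sum fun S _ => HasDerivAt.comp (g z) ?_ hGd
      rw [hGz]; exact hI S z
    rw [h1.unique h2, ← Finset.sum_mul, Finset.sum_neg_distrib, ← Finset.sum_mul, hw1]
    exact mul_ne_zero (by simpa using (phi_pos z).ne') (inv_ne_zero hg')
  let q : ℝ → ℝ := hK.implicitFunction (by simp) hinv
  have hq0 : q 0 = g z := hK.implicitFunction_apply_self (by simp) hinv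
  have hqC : ContDiffAt ℝ 2 q 0 := hK.contDiffAt_implicitFunction (by simp) hinv
  have hqK : ∀ᶠ h in 𝓝 (0 : ℝ), K (h, q h) = α := by
    have := hK.eventually_apply_implicitFunction (by simp) hinv
    rwa [hK0] at this
  have huniq : ∀ᶠ p in 𝓝 ((0 : ℝ), g z), K p = α → q p.1 = p.2 := by
    filter_upwards [hK.eventually_apply_eq_iff_implicitFunction (by simp) hinv] with p hp h
    rw [hK0] at hp
    exact hp.1 h
  have hpair : ContDiffAt ℝ 2 (fun h => (h, q h)) 0 := contDiffAt_id.prodMk hqC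
  have hpair0 : (fun h => (h, q h)) 0 = ((0 : ℝ), g z) := by simp [hq0]
  have hlift : ∀ {p : ℝ × ℝ → Prop}, (∀ᶠ v in 𝓝 ((0 : ℝ), g z), p v) →
      ∀ᶠ h in 𝓝 (0 : ℝ), p (h, q h) := fun hp =>
    hpair.continuousAt.eventually (by rw [hpair0]; exact hp)
  refine ⟨q, fun S h => x' S (h, q h), hq0, hqC, fun S => ?_, fun S => ?_, fun S => ?_, hqK, ?_⟩
  · refine ContDiffAt.comp (0 : ℝ) (g := x' S) ?_ hpair
    rw [hq0]; exact hx' S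
  · simp only [hq0, hx'0]
  · exact (hlift hrel).mono fun h hh => hh.2 S
  · have hKF : ∀ᶠ p in 𝓝 ((0 : ℝ), g z), F p.1 p.2 = K p :=
      hrel.mono fun p hp => hF _ _ _ hp.1 hp.2
    filter_upwards [hqK, hlift (hKF.and huniq).eventually_nhds] with h h1 h2
    have h3 : F h (q h) = α := by rw [h2.self_of_nhds.1, h1]
    refine ⟨h3.ge, fun y hy => ?_⟩
    by_contra! hlt
    have h4 : ∀ᶠ y' in 𝓝 (q h), F h y' = K (h, y') ∧ (K (h, y') = α → q h = y') :=
      (Continuous.prodMk_right h).continuousAt.eventually h2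
    -- If some `y < q h` also reached level `α`, monotonicity would force `F h = α` on all of `[y, q
    -- h]`, producing roots arbitrarily close to `q h` against local uniqueness.
    have h5 : ∀ᶠ y' in 𝓝[<] q h, y < y' ∧ y' < q h ∧
        F h y' = K (h, y') ∧ (K (h, y') = α → q h = y') := by
      filter_upwards [nhdsWithin_le_nhds h4, self_mem_nhdsWithin,
        nhdsWithin_le_nhds (lt_mem_nhds hlt)] with y' a b c
      exact ⟨c, b, a⟩
    obtain ⟨y', hy1, hy2, hy3, hy4⟩ := h5.exists
    have h6 : F h y' = α :=
      le_antisymm (h3 ▸ hmono h hy2.le) (le_trans hy (hmono h hy1.le))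
    exact hy2.ne' (hy4 (hy3 ▸ h6))

end Calculus

/-! ### Smoothness and derivatives of the conditional loss and pattern probabilities. -/

variable {n : ℕ}

theorem hasDerivAt_condProb {ρ : ℝ} (hρ : 0 ≤ 1 - ρ) (c x : ℝ) :
    HasDerivAt (fun x => Phi (threshold ρ c x))
      (-(√(ρ / (1 - ρ)) * phi (threshold ρ c x))) x := by
  have h : HasDerivAt (threshold ρ c) (-√(ρ / (1 - ρ))) x := by
    refine ((((hasDerivAt_id x).const_mul (√ρ)).const_sub c).div_const (√(1 - ρ))).congr_deriv ?_
    rw [Real.sqrt_div' _ hρ]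
    ring
  exact ((hasDerivAt_Phi (threshold ρ c x)).comp x h).congr_deriv (by ring)

theorem hasDerivAt_condLoss {u ρ c : Fin n → ℝ} (hρ : ∀ i, 0 < ρ i ∧ ρ i < 1) (x : ℝ) :
    HasDerivAt (condLoss u ρ c)
      (∑ i, u i * -(√(ρ i / (1 - ρ i)) * phi (threshold (ρ i) (c i) x))) x :=
  HasDerivAt.fun_sum fun i _ =>
    (hasDerivAt_condProb (sub_nonneg.2 (hρ i).2.le) (c i) x).const_mul (u i)

theorem deriv_condLoss_neg {u ρ c : Fin n → ℝ} (hρ : ∀ i, 0 < ρ i ∧ ρ i < 1)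
    (hu : ∀ i, 0 ≤ u i) (hu_pos : ∃ i, 0 < u i) (x : ℝ) : deriv (condLoss u ρ c) x < 0 := by
  rw [(hasDerivAt_condLoss hρ x).deriv]
  have hpos : ∀ i, 0 < √(ρ i / (1 - ρ i)) * phi (threshold (ρ i) (c i) x) := fun i =>
    mul_pos (Real.sqrt_pos.2 (div_pos (hρ i).1 (sub_pos.2 (hρ i).2))) (phi_pos _)
  obtain ⟨i, hi⟩ := hu_pos
  refine Finset.sum_neg' (fun j _ => ?_) ⟨i, Finset.mem_univ i, ?_⟩
  · exact mul_nonpos_of_nonneg_of_nonpos (hu j) (neg_nonpos.2 (hpos j).le)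
  · exact mul_neg_of_pos_of_neg hi (neg_neg_of_pos (hpos i))

/-- The conditional probability, given `X = x`, that exactly the assets in `S` default. -/
noncomputable def condPattern (ρ c : Fin n → ℝ) (S : Finset (Fin n)) (x : ℝ) : ℝ :=
  patternProb (fun i => Phi (threshold (ρ i) (c i) x)) S

theorem contDiff_condPattern (ρ c : Fin n → ℝ) (S : Finset (Fin n)) :
    ContDiff ℝ 2 (condPattern ρ c S) :=
  contDiff_patternProb (fun i => contDiff_condProb (ρ i) (c i)) S

theorem integrable_condPattern_mul_phi (ρ c : Fin n → ℝ) (S : Finset (Fin n)) :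
    Integrable fun x => condPattern ρ c S x * phi x := by
  refine integrable_phi.bdd_mul (c := 1)
    (contDiff_condPattern ρ c S).continuous.aestronglyMeasurable (Eventually.of_forall fun x => ?_)
  rw [Real.norm_eq_abs, condPattern, abs_of_nonneg
    (patternProb_nonneg (fun i => Phi_nonneg _) (fun i => Phi_le_one _) S)]
  exact patternProb_le_one (fun i => Phi_nonneg _) (fun i => Phi_le_one _) S

theorem hasDerivAt_integral_condPattern (ρ c : Fin n → ℝ) (S : Finset (Fin n)) (a : ℝ) :
    HasDerivAt (fun a => ∫ x in Ici a, condPattern ρ c S x * phi x)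
      (-(condPattern ρ c S a * phi a)) a :=
  hasDerivAt_integral_Ici ((contDiff_condPattern ρ c S).mul contDiff_phi).continuous
    (integrable_condPattern_mul_phi ρ c S) a

theorem contDiff_integral_condPattern (ρ c : Fin n → ℝ) (S : Finset (Fin n)) :
    ContDiff ℝ 2 fun a => ∫ x in Ici a, condPattern ρ c S x * phi x :=
  contDiff_two_of_hasDerivAt (hasDerivAt_integral_condPattern ρ c S)
    (((contDiff_condPattern ρ c S).mul contDiff_phi).neg.of_le (by norm_num))

theorem sum_integral_condPattern (ρ c : Fin n → ℝ) (a : ℝ) :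
    ∑ S, ∫ x in Ici a, condPattern ρ c S x * phi x = 1 - Phi a := by
  rw [← integral_finsetSum _ fun S _ => (integrable_condPattern_mul_phi ρ c S).integrableOn]
  simp_rw [← Finset.sum_mul, condPattern, sum_patternProb]
  rw [integral_Ici_eq_integral_Ioi, ← setIntegral_gaussian (fun _ => 1) (Ioi a) measurableSet_Ioi,
    Phi, cdf_eq_real, ← probReal_compl_eq_one_sub measurableSet_Iic]
  simp

/-- With the centre frozen at `g z`, the second moment at `x` is `(g z - g x) ^ 2` plus the
conditional variance. The square has zero derivative at `z`, so only the derivative of the variance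
remains. -/
theorem sum_deriv_condPattern_mul_sq {u ρ c : Fin n → ℝ} (hρ : ∀ i, 0 < ρ i ∧ ρ i < 1) (z : ℝ) :
    ∑ S, deriv (condPattern ρ c S) z * (condLoss u ρ c z - ∑ i ∈ S, u i) ^ 2 =
      -∑ i, u i ^ 2 * √(ρ i / (1 - ρ i)) * phi (threshold (ρ i) (c i) z) *
        (1 - 2 * Phi (threshold (ρ i) (c i) z)) := by
  have h1 : HasDerivAt (fun x => ∑ S, condPattern ρ c S x * (condLoss u ρ c z - ∑ i ∈ S, u i) ^ 2)
      (∑ S, deriv (condPattern ρ c S) z * (condLoss u ρ c z - ∑ i ∈ S, u i) ^ 2) z :=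
    HasDerivAt.fun_sum fun S _ =>
      (((contDiff_condPattern ρ c S).differentiable (by simp) z).hasDerivAt).mul_const _
  have h2 : (fun x => ∑ S, condPattern ρ c S x * (condLoss u ρ c z - ∑ i ∈ S, u i) ^ 2) =
      fun x => (condLoss u ρ c z - condLoss u ρ c x) ^ 2 +
        ∑ i, u i ^ 2 * (Phi (threshold (ρ i) (c i) x) - Phi (threshold (ρ i) (c i) x) ^ 2) := by
    funext x
    exact sum_patternProb_mul_sub_sq _ u _
  rw [h2] at h1
  have hp := fun i => hasDerivAt_condProb (sub_nonneg.2 (hρ i).2.le) (c i) z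
  have h3 := (((hasDerivAt_condLoss (u := u) (c := c) hρ z).const_sub
    (condLoss u ρ c z)).fun_pow 2).add (HasDerivAt.fun_sum (u := Finset.univ) fun i _ =>
      ((hp i).sub ((hp i).fun_pow 2)).const_mul (u i ^ 2))
  rw [h1.unique h3]
  simp only [sub_self, Nat.cast_ofNat]
  rw [show (0 : ℝ) ^ (2 - 1) = 0 by norm_num, mul_zero, zero_mul, zero_add, ← Finset.sum_neg_distrib]
  exact Finset.sum_congr rfl fun i _ => by ring

theorem path_sublevel_eq_Ici {g : ℝ → ℝ} (hg : StrictAnti g) {h l y a : ℝ} (hh : h < 1)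
    (hy : y = (1 - h) * g a + h * l) : {x | g x + h * (l - g x) ≤ y} = Ici a := by
  ext x
  rw [mem_Ici, ← hg.le_iff_ge, ← mul_le_mul_iff_right₀ (sub_pos.2 hh), mem_ofPred_eq, hy]
  constructor <;> intro h' <;> linarith

end Granularity

/-! ### The second order expansion of the quantile. -/

theorem proposition1 {Ω : Type*} [MeasurableSpace Ω] (P : Measure Ω) [IsProbabilityMeasure P]
    (n : ℕ) (u ρ c : Fin n → ℝ) (X : Ω → ℝ) (ξ : Fin n → Ω → ℝ) (α : ℝ)
    (hu : ∀ i, 0 ≤ u i) (hu_pos : ∃ i, 0 < u i)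
    (hρ : ∀ i, 0 < ρ i ∧ ρ i < 1)
    (hX_meas : Measurable X) (hξ_meas : ∀ i, Measurable (ξ i))
    (hX_law : P.map X = gaussianReal 0 1)
    (hξ_law : ∀ i, P.map (ξ i) = gaussianReal 0 1)
    (h_indep : iIndepFun (fun k : Option (Fin n) => k.elim X ξ) P)
    (hα : 0 < α ∧ α < 1) :
    let L : Ω → ℝ := Granularity.portfolioLoss u ρ c X ξ
    let g : ℝ → ℝ := Granularity.condLoss u ρ c
    let Q : ℝ → ℝ := Granularity.quantilePath P α L X
    let z : ℝ := Granularity.quantile P (1 - α) X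
    let t : Fin n → ℝ := fun i => Granularity.threshold (ρ i) (c i) z
    -- the objects in the expansion exist
    Granularity.systematicPart P L X =ᵐ[P] (fun ω => g (X ω)) ∧
    ContDiff ℝ 2 g ∧ deriv g z ≠ 0 ∧
    ContDiffAt ℝ 2 Q 0 ∧
    Q 1 = Granularity.quantile P α L ∧
    -- the second order Taylor approximation of `q_α(L)`
    Granularity.taylorTwo Q =
      g z +
        ((∑ i, u i ^ 2 * √(ρ i / (1 - ρ i)) * Granularity.phi (t i) *
              (1 - 2 * Granularity.Phi (t i))) +
          (z + deriv (deriv g) z / deriv g z) *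
            ∑ i, u i ^ 2 * (Granularity.Phi (t i) - Granularity.Phi (t i) ^ 2)) *
        (2 * deriv g z)⁻¹ := by
  intro L g Q z t
  have hρ1 : ∀ i, ρ i < 1 := fun i => (hρ i).2
  have hg2 : ContDiff ℝ 2 g := Granularity.contDiff_condLoss u ρ c
  have hgneg : ∀ x, deriv g x < 0 := Granularity.deriv_condLoss_neg hρ hu hu_pos
  have hganti : StrictAnti g := strictAnti_of_deriv_neg hgneg
  have hz : Granularity.Phi z = 1 - α :=
    Granularity.Phi_quantile hX_meas hX_law (by linarith [hα.2]) (by linarith [hα.1])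
  have hw1 : ∑ S, Granularity.condPattern ρ c S z = 1 := Granularity.sum_patternProb _
  have hI := Granularity.hasDerivAt_integral_condPattern ρ c
  obtain ⟨q, x, hq0, hqC, hxC, hx0, hqx, hsum, hleast⟩ :=
    Granularity.exists_local_root_of_pattern_sum (g := g) (z := z) (α := α)
      (w := Granularity.condPattern ρ c) (l := fun S => ∑ i ∈ S, u i)
      (F := fun h y => P.real {ω | Granularity.systematicPart P L X ω +
        h * (L ω - Granularity.systematicPart P L X ω) ≤ y})
      hg2 (hgneg z).ne hI (Granularity.contDiff_integral_condPattern ρ c) hw1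
      -- The level at `h = 0` is the upper tail `1 - Φ(z) = α`: large losses correspond to small
      -- `X`, whence the quantile of order `1 - α`.
      (by rw [Granularity.sum_integral_condPattern, hz]; ring)
      (fun h y y' hy => measureReal_mono fun ω hω => le_trans hω hy)
      (fun h y a hh hy => by
        refine (Granularity.measureReal_path_le hX_meas hξ_meas hX_law hξ_law h_indep u c hρ1
          h y).trans (Finset.sum_congr rfl fun S _ => ?_)
        rw [Granularity.path_sublevel_eq_Ici hganti hh (hy S)]
        rfl)
  have hQq : Q =ᶠ[nhds 0] q := hleast.mono fun h hh => hh.csInf_eq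
  have hwl : ∑ S, Granularity.condPattern ρ c S z * (g z - ∑ i ∈ S, u i) = 0 := by
    simp_rw [mul_sub, Finset.sum_sub_distrib, ← Finset.sum_mul]
    rw [hw1, one_mul, sub_eq_zero]
    exact (Granularity.sum_patternProb_mul_sum _ u).symm
  have hσ : ∑ S, Granularity.condPattern ρ c S z * (g z - ∑ i ∈ S, u i) ^ 2 =
      ∑ i, u i ^ 2 * (Granularity.Phi (t i) - Granularity.Phi (t i) ^ 2) := by
    refine (Granularity.sum_patternProb_mul_sub_sq _ u (g z)).trans ?_
    rw [show g z = ∑ i, u i * Granularity.Phi (Granularity.threshold (ρ i) (c i) z) from rfl]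
    simp [t]
  obtain ⟨hq1, hq2⟩ := Granularity.implicit_first_second_deriv hg2 (hgneg z).ne hxC hx0 hqx hI
    (fun S => (Granularity.contDiff_condPattern ρ c S).differentiable (by simp) z) hsum hw1 hwl
  refine ⟨Granularity.systematicPart_ae_eq hX_meas hξ_meas hX_law hξ_law h_indep u c hρ1, hg2,
    (hgneg z).ne, hqC.congr_of_eventuallyEq hQq, ?_, ?_⟩
  · simp only [Q, Granularity.quantilePath]
    congr 1
    funext ω
    ring
  · rw [Granularity.taylorTwo, hQq.self_of_nhds, hQq.deriv_eq, hQq.deriv.deriv_eq, hq0, hq1, hq2,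
      hσ, Granularity.sum_deriv_condPattern_mul_sq hρ]
    simp only [t]
    have := (hgneg z).ne
    field_simp
    ring
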